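/- Let $\ell^2$ be the real Hilbert space of square-summable real sequences with inner product $\langle\cdot,\cdot\rangle$. A function $K\colon X\times X\to\mathbb{C}$ is called a positive definite kernel on $X$ if $\sum_{i,j=1}^m c_i\overline{c_j}K(x_i,x_j)\ge 0$ for all $m\in\mathbb{N}$, $x_1,\dots,x_m\in X$ and $c\in\mathbb{C}^m$; it is called strictly positive definite if moreover this inequality is strict whenever $x_1,\dots,x_m$ are distinct and $c\ne 0$. Throughout, $\langle x,y\rangle^0=1$. 1. Let $K(x,y)=\kappa(\langle x,y\rangle)$, with $\kappa\colon\mathbb{R}\to\mathbb{C}$, be a continuous positive definite kernel on $\ell^2$. Then there are real numbers $a_n\ge 0$ $(n\ge 0)$ such that $(a_nt^n)_{n\ge 0}\in\ell^1$ for all $t\in\mathbb{R}$ and $$K(x,y)=\sum_{n=0}^\infty a_n\langle x,y\rangle^n\qquad\text{for all }x,y\in\ell^2.$$ 2. Conversely, if $a_n\ge 0$ for all $n\ge 0$ and $(a_nt^n)_{n\ge 0}\in\ell^1$ for all $t\in\mathbb{R}$, then $K(x,y)=\sum_{n=0}^\infty a_n\langle x,y\rangle^n$ is well defined and is a continuous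 positive definite kernel on $\ell^2$ that depends only on $\langle x,y\rangle$. 3. Let $K$ be a positive definite kernel on $\ell^2$ of the form $K(x,y)=\sum_{n=0}^\infty a_n\langle x,y\rangle^n$, with $a_n\in\mathbb{R}$ and the series absolutely convergent for all $x,y\in\ell^2$. Then $K$ is strictly positive definite on $\ell^2$ if and only if $a_0>0$ and $a_n>0$ holds for infinitely many even and infinitely many odd indices $n$. The restriction of $K$ to $\ell^2\setminus\{0\}$ is strictly positive definite if and only if $a_n>0$ holds for infinitely many even and infinitely many odd indices $n$. -/

import Mathlib

/-- The real Hilbert space `ℓ²` of square-summable real sequences. -/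
abbrev EllTwo : Type := lp (fun _ : ℕ => ℝ) 2

open scoped ComplexOrder in
/-- Positive definite kernels: `∑ c_i conj(c_j) K(x_i, x_j) ≥ 0` for all finite families.
For complex numbers, `0 ≤ z` means that `z` is real and nonnegative. -/
def IsPosDefKernel {X : Type*} (K : X → X → ℂ) : Prop :=
  ∀ (m : ℕ) (x : Fin m → X) (c : Fin m → ℂ),
    0 ≤ ∑ i, ∑ j, c i * (starRingEnd ℂ) (c j) * K (x i) (x j)

open scoped ComplexOrder in
/-- Strictly positive definite kernels: positive definite, with strict inequality whenever the
points are distinct and the coefficient vector is nonzero. -/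
def IsStrictlyPosDefKernel {X : Type*} (K : X → X → ℂ) : Prop :=
  IsPosDefKernel K ∧
    ∀ (m : ℕ) (x : Fin m → X) (c : Fin m → ℂ), Function.Injective x → c ≠ 0 →
      0 < ∑ i, ∑ j, c i * (starRingEnd ℂ) (c j) * K (x i) (x j)

/-- `K` depends on the dot product only: `K(x, y) = κ(⟨x, y⟩)`. -/
def IsDotProductFunction (K : EllTwo → EllTwo → ℂ) : Prop :=
  ∃ κ : ℝ → ℂ, ∀ x y : EllTwo, K x y = κ (inner ℝ x y)

/-- `K(x, y) = ∑ a_n ⟨x, y⟩ ^ n`, the series converging (absolutely) for all `x` and `y`;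
here `⟨x, y⟩ ^ 0 = 1`. -/
def HasDotProductExpansion (K : EllTwo → EllTwo → ℂ) (a : ℕ → ℝ) : Prop :=
  ∀ x y : EllTwo, HasSum (fun n : ℕ => ((a n * (inner ℝ x y) ^ n : ℝ) : ℂ)) (K x y)

/-! Positive semidefinite matrices are Gram matrices of vectors in ℓ², so a positive definite kernel
κ(⟨x, y⟩) is real and κ preserves positive semidefiniteness entrywise in every dimension. Such
preservers are classified with Krein–Milman. The normalized preservers on [-1, 1] form a compact
convex set for pointwise convergence. Since f(t) ± f(at)/2 is again a preserver for |a| ≤ 1, an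
extreme f is multiplicative (`map_mul_of_mem_extremePoints`), hence on (-1, 1) it is zero, one, or a
signed power. Difference quotients of preservers are preservers; they lower the exponent by one and
flip the parity, which leaves only monomials. Power series with nonnegative coefficients of mass at
most one form a closed convex set containing the extreme points, hence all normalized preservers
(`normalizedPreservers_subset_subprobabilitySeries`). Rescaling and uniqueness of coefficients give
an entire series.

The converse is Schur's product theorem. For strictness, the form is ∑ a_n Q_n with Q_n ≥ 0; it
vanishes only if ∑ c_i ⟨x_i, y⟩^n = 0 for all y whenever a_n > 0. For y separating the points,
growth along even and along odd n kills the coefficients of nonzero points. If one parity has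
finitely many positive a_n, weights on points ±k e annihilate the form. The origin is seen only by
the term n = 0, whence the condition on a_0. -/

section

open Filter Topology Set

/-! ### Entrywise preservers of positive semidefiniteness -/

/-- `f` preserves positive semidefiniteness when applied entrywise to real matrices with entries
in `s`. -/
def PreservesPosSemidef (s : Set ℝ) (f : ℝ → ℝ) : Prop :=
  ∀ (ι : Type) [Fintype ι] (A : Matrix ι ι ℝ), A.PosSemidef → (∀ i j, A i j ∈ s) →
    ∀ c : ι → ℝ, 0 ≤ ∑ i, ∑ j, c i * c j * f (A i j)

theorem dotProduct_mulVec_eq_quadratic {ι : Type*} [Fintype ι] (A : Matrix ι ι ℝ) (c : ι → ℝ) :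
    dotProduct (star c) (A.mulVec c) = ∑ i, ∑ j, c i * c j * A i j := by
  simp only [dotProduct, Matrix.mulVec, Pi.star_apply, star_trivial, Finset.mul_sum]
  exact Finset.sum_congr rfl fun i _ => Finset.sum_congr rfl fun j _ => by ring

theorem posSemidef_of_quadratic_nonneg {ι : Type*} [Fintype ι] {A : Matrix ι ι ℝ}
    (hsymm : ∀ i j, A i j = A j i) (h : ∀ c : ι → ℝ, 0 ≤ ∑ i, ∑ j, c i * c j * A i j) :
    A.PosSemidef := by
  refine Matrix.PosSemidef.of_dotProduct_mulVec_nonneg ?_ fun c => ?_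
  · ext i j
    simpa using hsymm j i
  · exact (h c).trans_eq (dotProduct_mulVec_eq_quadratic A c).symm

theorem Matrix.PosSemidef.quadratic_nonneg {ι : Type*} [Fintype ι] {A : Matrix ι ι ℝ}
    (hA : A.PosSemidef) (c : ι → ℝ) : 0 ≤ ∑ i, ∑ j, c i * c j * A i j :=
  (hA.dotProduct_mulVec_nonneg c).trans_eq (dotProduct_mulVec_eq_quadratic A c)

namespace PreservesPosSemidef

variable {s : Set ℝ} {f g : ℝ → ℝ}

theorem congr (hf : PreservesPosSemidef s f) (h : EqOn f g s) : PreservesPosSemidef s g := by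
  intro ι _ A hA hs c
  simpa only [h (hs _ _)] using hf ι A hA hs c

theorem of_tendsto {β : Type*} {l : Filter β} [l.NeBot] {F : β → ℝ → ℝ}
    (hF : ∀ᶠ b in l, PreservesPosSemidef s (F b))
    (hlim : ∀ t ∈ s, Tendsto (fun b => F b t) l (𝓝 (f t))) : PreservesPosSemidef s f := by
  intro ι _ A hA hs c
  refine ge_of_tendsto (tendsto_finsetSum _ fun i _ => tendsto_finsetSum _ fun j _ =>
    (hlim _ (hs i j)).const_mul (c i * c j)) ?_
  filter_upwards [hF] with b hb using hb ι A hA hs c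

theorem add (hf : PreservesPosSemidef s f) (hg : PreservesPosSemidef s g) :
    PreservesPosSemidef s fun t => f t + g t := by
  intro ι _ A hA hs c
  simpa only [mul_add, Finset.sum_add_distrib] using add_nonneg (hf ι A hA hs c) (hg ι A hA hs c)

theorem const_mul (hf : PreservesPosSemidef s f) {r : ℝ} (hr : 0 ≤ r) :
    PreservesPosSemidef s fun t => r * f t := by
  intro ι _ A hA hs c
  simpa only [mul_left_comm _ r, ← Finset.mul_sum] using mul_nonneg hr (hf ι A hA hs c)

theorem nonneg (hf : PreservesPosSemidef s f) {t : ℝ} (ht : 0 ≤ t) (hs : t ∈ s) : 0 ≤ f t := by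
  simpa using hf Unit (fun _ _ => t)
    (posSemidef_of_quadratic_nonneg (fun _ _ => rfl) fun c => by
      simpa using mul_nonneg (mul_self_nonneg (c ())) ht) (fun _ _ => hs) fun _ => 1

/-- Testing a preserver on the block matrix with blocks `A`, `a A`. -/
theorem add_comp_mul (hf : PreservesPosSemidef (Icc (-1) 1) f) {a ε : ℝ} (ha : a ∈ Icc (-1) 1)
    (hε : ε * ε = 1) : PreservesPosSemidef (Icc (-1) 1) fun t => f t + ε * f (a * t) := by
  intro ι _ A hA hs c
  let M : Matrix (Fin 2) (Fin 2) ℝ := fun p q => if p = q then 1 else a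
  have hM : M.PosSemidef := by
    refine posSemidef_of_quadratic_nonneg (fun i j => by simp [M, eq_comm]) fun d => ?_
    simp only [M, Fin.sum_univ_two]
    norm_num
    nlinarith [ha.1, ha.2, mul_nonneg (by linarith [ha.1] : 0 ≤ 1 + a) (sq_nonneg (d 0 + d 1)),
      mul_nonneg (by linarith [ha.2] : 0 ≤ 1 - a) (sq_nonneg (d 0 - d 1))]
  -- This is the Kronecker product of `A` and `M`. Tested on (c, εc) it gives twice the desired
  -- form, because ε² = 1.
  let B : Matrix (ι × Fin 2) (ι × Fin 2) ℝ := fun x y => A x.1 y.1 * if x.2 = y.2 then 1 else a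
  have hB := hf (ι × Fin 2) B (hA.kronecker hM) (fun x y => by
    have h1 := abs_le.2 (hs x.1 y.1)
    have h2 := abs_le.2 ha
    simp only [B]
    split_ifs
    · simpa using hs x.1 y.1
    · rw [mem_Icc, ← abs_le, abs_mul]
      exact mul_le_one₀ h1 (abs_nonneg _) h2) fun x => c x.1 * if x.2 = 0 then 1 else ε
  simp only [Fintype.sum_prod_type, Fin.sum_univ_two, B] at hB
  norm_num [← Finset.sum_add_distrib] at hB
  have : ∑ i, ∑ j, c i * c j * (f (A i j) + ε * f (a * A i j)) =
      1 / 2 * ∑ x, ∑ x_1, (c x * c x_1 * f (A x x_1) + c x * (c x_1 * ε) * f (A x x_1 * a) +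
        (c x * ε * c x_1 * f (A x x_1 * a) + c x * ε * (c x_1 * ε) * f (A x x_1))) := by
    simp only [Finset.mul_sum]
    refine Finset.sum_congr rfl fun i _ => Finset.sum_congr rfl fun j _ => ?_
    rw [mul_comm a]
    linear_combination (- 1 / 2 * c i * c j * f (A i j)) * hε
  rw [this]
  linarith

/-- Testing a preserver on the block matrix with blocks `A`, `A`, `A`, `A + h`. -/
theorem sub_shift (hf : PreservesPosSemidef univ f) {h : ℝ} (hh : 0 ≤ h) :
    PreservesPosSemidef univ fun t => f (t + h) - f t := by
  intro ι _ A hA _ c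
  let B : Matrix (ι × Fin 2) (ι × Fin 2) ℝ := fun x y =>
    A x.1 y.1 + if x.2 = 1 ∧ y.2 = 1 then h else 0
  have hB : B.PosSemidef := by
    have h1 := hA.submatrix (Prod.fst : ι × Fin 2 → ι)
    have h2 : Matrix.PosSemidef (fun x y : ι × Fin 2 => if x.2 = 1 ∧ y.2 = 1 then h else 0) := by
      refine posSemidef_of_quadratic_nonneg (fun i j => by simp only [and_comm]) fun d => ?_
      have : ∑ i : ι × Fin 2, ∑ j : ι × Fin 2, d i * d j * (if i.2 = 1 ∧ j.2 = 1 then h else 0) =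
          h * (∑ i : ι × Fin 2, d i * if i.2 = 1 then 1 else 0) ^ 2 := by
        rw [sq, Finset.sum_mul_sum, Finset.mul_sum]
        refine Finset.sum_congr rfl fun i _ => ?_
        rw [Finset.mul_sum]
        refine Finset.sum_congr rfl fun j _ => ?_
        by_cases hi : i.2 = 1 <;> by_cases hj : j.2 = 1 <;> simp [hi, hj]
        ring
      rw [this]
      positivity
    exact h1.add h2
  -- On the vector (-c, c) the three blocks `A` contribute with signs +, -, -, and the shifted block
  -- with +.
  have key := hf _ B hB (fun _ _ => mem_univ _) fun x => c x.1 * if x.2 = 0 then -1 else 1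
  simp only [Fintype.sum_prod_type, Fin.sum_univ_two, B] at key
  norm_num [← Finset.sum_add_distrib] at key
  convert key using 4
  ring

/-- The Gram matrix of `(1, 0)`, `(1, 1)`, `(0, 1)`. -/
theorem not_step_at_zero (hf : PreservesPosSemidef univ f) (h0 : f 0 = 0)
    (h1 : f 1 = 1) (h2 : f 2 = 1) : False := by
  have key := hf (Fin 3) !![1, 1, 0; 1, 2, 1; 0, 1, 1]
    (posSemidef_of_quadratic_nonneg (fun i j => by fin_cases i <;> fin_cases j <;> simp)
      fun c => by
        simp [Fin.sum_univ_three]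
        nlinarith [sq_nonneg (c 0 + c 1), sq_nonneg (c 1 + c 2)])
    (fun _ _ => mem_univ _) ![1, -1, 1]
  simp [Fin.sum_univ_three, h0, h1, h2] at key
  linarith

/-- The Gram matrix of `(1, 0)`, `(0, 1)`, `(-1, 0)`. -/
theorem not_sign (hf : PreservesPosSemidef univ f) (h0 : f 0 = 1)
    (h1 : f 1 = 1) (h2 : f (-1) = -1) : False := by
  have key := hf (Fin 3) !![1, 0, -1; 0, 1, 0; -1, 0, 1]
    (posSemidef_of_quadratic_nonneg (fun i j => by fin_cases i <;> fin_cases j <;> simp)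
      fun c => by
        simp [Fin.sum_univ_three]
        nlinarith [sq_nonneg (c 0 - c 2), sq_nonneg (c 1)])
    (fun _ _ => mem_univ _) ![1, -1, 1]
  simp [Fin.sum_univ_three, h0, h1, h2] at key
  linarith

end PreservesPosSemidef

/-! ### Signed powers -/

/-- The function `t ↦ t ^ α` for `t > 0`, extended to `t < 0` with `f (-t) = ε * f t`. -/
noncomputable def signedPower (α ε t : ℝ) : ℝ :=
  if 0 < t then t ^ α else if t < 0 then ε * (-t) ^ α else 0

theorem signedPower_of_pos (α ε : ℝ) {t : ℝ} (ht : 0 < t) : signedPower α ε t = t ^ α := if_pos ht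

theorem signedPower_of_neg (α ε : ℝ) {t : ℝ} (ht : t < 0) :
    signedPower α ε t = ε * (-t) ^ α := by
  rw [signedPower, if_neg ht.not_gt, if_pos ht]

theorem signedPower_zero (α ε : ℝ) : signedPower α ε 0 = 0 := by simp [signedPower]

theorem signedPower_mul (α ε : ℝ) {r : ℝ} (hr : 0 < r) (t : ℝ) :
    signedPower α ε (r * t) = r ^ α * signedPower α ε t := by
  rcases lt_trichotomy t 0 with ht | rfl | ht
  · rw [signedPower_of_neg _ _ ht, signedPower_of_neg _ _ (mul_neg_of_pos_of_neg hr ht),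
      ← mul_neg, Real.mul_rpow hr.le (by linarith)]
    ring
  · simp [signedPower_zero]
  · rw [signedPower_of_pos _ _ ht, signedPower_of_pos _ _ (mul_pos hr ht),
      Real.mul_rpow hr.le ht.le]

/-- Differentiation lowers the exponent and flips the parity. The quotient is one-sided because
`sub_shift` needs h ≥ 0; at t = 0 it equals h^(α - 1), which tends to 0 as α > 1. -/
theorem tendsto_slope_signedPower {α : ℝ} (hα : 1 < α) (ε t : ℝ) :
    Tendsto (fun h => h⁻¹ * (signedPower α ε (t + h) - signedPower α ε t)) (𝓝[>] 0)
      (𝓝 (α * signedPower (α - 1) (-ε) t)) := by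
  rcases lt_trichotomy t 0 with ht | rfl | ht
  · have h1 : HasDerivAt (signedPower α ε) (α * signedPower (α - 1) (-ε) t) t := by
      have h2 : HasDerivAt (fun t : ℝ => ε * (-t) ^ α) (α * signedPower (α - 1) (-ε) t) t := by
        refine ((((hasDerivAt_id t).neg).rpow_const (p := α)
          (Or.inr hα.le)).const_mul ε).congr_deriv ?_
        rw [signedPower_of_neg _ _ ht]
        simp
        ring
      refine h2.congr_of_eventuallyEq ?_
      filter_upwards [Iio_mem_nhds ht] with u hu using signedPower_of_neg _ _ hu
    simpa using h1.tendsto_slope_zero_right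
  · have h1 : Tendsto (fun h : ℝ => h ^ (α - 1)) (𝓝[>] 0) (𝓝 ((0 : ℝ) ^ (α - 1))) :=
      ((Real.continuousAt_rpow_const 0 (α - 1) (Or.inr (by linarith))).tendsto).mono_left
        nhdsWithin_le_nhds
    rw [Real.zero_rpow (by linarith)] at h1
    simp only [signedPower_zero, zero_add, sub_zero, mul_zero]
    refine h1.congr' ?_
    filter_upwards [self_mem_nhdsWithin] with h hh
    rw [signedPower_of_pos _ _ hh, Real.rpow_sub_one (ne_of_gt hh)]
    ring
  · have h1 : HasDerivAt (signedPower α ε) (α * signedPower (α - 1) (-ε) t) t := by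
      have h2 : HasDerivAt (fun t : ℝ => t ^ α) (α * signedPower (α - 1) (-ε) t) t := by
        rw [signedPower_of_pos _ _ ht]
        exact Real.hasDerivAt_rpow_const (Or.inr hα.le)
      refine h2.congr_of_eventuallyEq ?_
      filter_upwards [Ioi_mem_nhds ht] with u hu using signedPower_of_pos _ _ hu
    simpa using h1.tendsto_slope_zero_right

theorem PreservesPosSemidef.signedPower_sub_one {α ε : ℝ} (hα : 1 < α)
    (h : PreservesPosSemidef univ (signedPower α ε)) :
    PreservesPosSemidef univ (signedPower (α - 1) (-ε)) := by
  have h1 : PreservesPosSemidef univ fun t => α * signedPower (α - 1) (-ε) t := by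
    refine of_tendsto (l := 𝓝[>] (0 : ℝ)) ?_ fun t _ => tendsto_slope_signedPower hα ε t
    filter_upwards [self_mem_nhdsWithin] with r hr
    exact (h.sub_shift (le_of_lt hr)).const_mul (inv_nonneg.2 (le_of_lt hr))
  have hα0 : α ≠ 0 := by linarith
  refine (h1.const_mul (inv_nonneg.2 (by linarith : 0 ≤ α))).congr fun t _ => ?_
  simp [hα0]

/-- A signed power preserving positive semidefiniteness is a monomial. -/
theorem PreservesPosSemidef.exists_eq_natCast_of_signedPower (n : ℕ) :
    ∀ {α ε : ℝ}, 0 ≤ α → α ≤ n → ε = 1 ∨ ε = -1 → PreservesPosSemidef univ (signedPower α ε) →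
      ∃ k : ℕ, k ≠ 0 ∧ α = k ∧ ε = (-1) ^ k := by
  have hzero : ∀ {ε : ℝ}, ¬ PreservesPosSemidef univ (signedPower 0 ε) := fun h =>
    h.not_step_at_zero (signedPower_zero _ _) (by simp [signedPower]) (by simp [signedPower])
  induction n with
  | zero =>
    intro α ε h0 h1 _ h
    obtain rfl : α = 0 := le_antisymm (by simpa using h1) h0
    exact (hzero h).elim
  | succ n ih =>
    intro α ε h0 h1 hε h
    rcases h0.eq_or_lt with rfl | h0
    · exact (hzero h).elim
    -- For 0 < α < 1 the second difference 2^α - 2 at 0 is negative. For α = 1 and ε = 1 the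
    -- function is |t|, and |t + 1| - |t| is excluded by `not_sign`. For α > 1 the derivative
    -- reduces to α - 1.
    rcases lt_trichotomy α 1 with hα | rfl | hα
    · have h2 := ((h.sub_shift zero_le_one).sub_shift zero_le_one).nonneg le_rfl (mem_univ 0)
      have h3 : (2 : ℝ) ^ α < 2 := by
        simpa using Real.rpow_lt_rpow_of_exponent_lt one_lt_two hα
      norm_num [signedPower] at h2
      linarith
    · rcases hε with rfl | rfl
      · exact ((h.sub_shift zero_le_one).not_sign (by simp [signedPower])
          (by norm_num [signedPower]) (by norm_num [signedPower])).elim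
      · exact ⟨1, one_ne_zero, by simp, by simp⟩
    · obtain ⟨k, -, hk, hεk⟩ := ih (by linarith) (by push_cast at h1; linarith)
        (by rcases hε with rfl | rfl <;> simp) (h.signedPower_sub_one hα)
      exact ⟨k + 1, k.succ_ne_zero, by push_cast; linarith, by rw [pow_succ, ← hεk]; ring⟩

/-- By homogeneity: shrinking a matrix into [-1, 1] multiplies its form by a positive constant. -/
theorem PreservesPosSemidef.signedPower_univ {α ε : ℝ}
    (h : PreservesPosSemidef (Icc (-1) 1) (signedPower α ε)) :
    PreservesPosSemidef univ (signedPower α ε) := by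
  intro ι _ A hA _ c
  set R : ℝ := 1 + ∑ i, ∑ j, |A i j|
  have hR : 0 < R := by positivity
  have hle : ∀ i j, |A i j| ≤ R := fun i j =>
    calc |A i j| ≤ ∑ j, |A i j| :=
          Finset.single_le_sum (f := fun j => |A i j|) (fun _ _ => abs_nonneg _) (Finset.mem_univ j)
      _ ≤ ∑ i, ∑ j, |A i j| := Finset.single_le_sum (f := fun i => ∑ j, |A i j|)
          (fun _ _ => Finset.sum_nonneg fun _ _ => abs_nonneg _) (Finset.mem_univ i)
      _ ≤ R := by simp [R]
  have key := h ι (R⁻¹ • A) (hA.smul (inv_nonneg.2 hR.le)) (fun i j => by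
    rw [mem_Icc, ← abs_le, Matrix.smul_apply, smul_eq_mul, abs_mul, abs_of_pos (inv_pos.2 hR),
      inv_mul_le_one₀ hR]
    exact hle i j) c
  simp only [Matrix.smul_apply, smul_eq_mul, signedPower_mul _ _ (inv_pos.2 hR),
    mul_left_comm _ (R⁻¹ ^ α), ← Finset.mul_sum] at key
  exact nonneg_of_mul_nonneg_right key (Real.rpow_pos_of_pos (inv_pos.2 hR) _)

/-! ### Normalized preservers and their extreme points -/

/-- The functions on `[-1, 1]`, extended by zero, that preserve positive semidefiniteness and are
normalized at `1`. -/
def normalizedPreservers : Set (ℝ → ℝ) :=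
  {f | PreservesPosSemidef (Icc (-1) 1) f ∧ f 1 = 1 ∧ ∀ t, t ∉ Icc (-1 : ℝ) 1 → f t = 0}

/-- The preservers s ↦ f(s) ± f(ts) are nonnegative at s = 1. -/
theorem PreservesPosSemidef.abs_le_apply_one {f : ℝ → ℝ} (hf : PreservesPosSemidef (Icc (-1) 1) f)
    {t : ℝ} (ht : t ∈ Icc (-1) 1) : |f t| ≤ f 1 := by
  have h1 := (hf.add_comp_mul ht (ε := 1) (by norm_num)).nonneg zero_le_one (by simp)
  have h2 := (hf.add_comp_mul ht (ε := -1) (by norm_num)).nonneg zero_le_one (by simp)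
  rw [abs_le]
  simp only [mul_one] at h1 h2
  constructor <;> linarith

theorem convex_normalizedPreservers : Convex ℝ normalizedPreservers := by
  rintro f ⟨hf, hf1, hf0⟩ g ⟨hg, hg1, hg0⟩ a b ha hb hab
  refine ⟨(hf.const_mul ha).add (hg.const_mul hb), by simp [hf1, hg1, hab], fun t ht => ?_⟩
  simp [hf0 t ht, hg0 t ht]

/-- Tychonoff: each defining condition involves finitely many values of f, so the set is closed in a
product of intervals [-1, 1]. -/
theorem isCompact_normalizedPreservers : IsCompact normalizedPreservers := by
  refine (isCompact_univ_pi fun _ : ℝ => isCompact_Icc (a := (-1 : ℝ)) (b := 1)).of_isClosed_subset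
    ?_ ?_
  · have h1 : IsClosed {f | PreservesPosSemidef (Icc (-1) 1) f} := by
      simp only [PreservesPosSemidef, Set.ofPred_forall]
      exact isClosed_iInter fun ι => isClosed_iInter fun _ => isClosed_iInter fun A =>
        isClosed_iInter fun _ => isClosed_iInter fun _ => isClosed_iInter fun c =>
          isClosed_le continuous_const (by fun_prop)
    have h2 : IsClosed {f : ℝ → ℝ | f 1 = 1} := isClosed_eq (by fun_prop) continuous_const
    have h3 : IsClosed {f : ℝ → ℝ | ∀ t, t ∉ Icc (-1 : ℝ) 1 → f t = 0} := by
      simp only [Set.ofPred_forall]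
      exact isClosed_iInter fun t => isClosed_iInter fun _ =>
        isClosed_eq (by fun_prop) continuous_const
    exact h1.inter (h2.inter h3)
  · rintro f ⟨hf, hf1, hf0⟩ t -
    by_cases ht : t ∈ Icc (-1 : ℝ) 1
    · simpa [hf1, abs_le] using hf.abs_le_apply_one ht
    · simp [hf0 t ht]

theorem map_mul_of_mem_extremePoints {f : ℝ → ℝ} (hf : f ∈ normalizedPreservers.extremePoints ℝ)
    {a t : ℝ} (ha : a ∈ Icc (-1) 1) (ht : t ∈ Icc (-1) 1) : f (a * t) = f a * f t := by
  classical
  obtain ⟨⟨hf, hf1, hf0⟩, hext⟩ := hf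
  have hfa := abs_le.1 (hf1 ▸ hf.abs_le_apply_one ha)
  -- f is a convex combination of the normalizations of f(t) ± f(at)/2. The factor 1/2 keeps both
  -- weights positive, since |f(a)| ≤ 1. Extremality then makes the first of them equal to f.
  let w : ℝ → ℝ := fun ε => 1 + ε * (1 / 2 * f a)
  let g : ℝ → ℝ → ℝ := fun ε t =>
    if t ∈ Icc (-1 : ℝ) 1 then (w ε)⁻¹ * (f t + ε * (1 / 2 * f (a * t))) else 0
  have hw : ∀ ε : ℝ, ε = 1 ∨ ε = -1 → 0 < w ε := by
    rintro ε (rfl | rfl) <;> simp only [w] <;> linarith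
  have hg : ∀ ε : ℝ, ε = 1 ∨ ε = -1 → g ε ∈ normalizedPreservers := by
    intro ε hε
    have h2 := (hf.const_mul (r := 1 / 2) (by norm_num)).add ((hf.add_comp_mul ha (ε := ε)
      (by rcases hε with rfl | rfl <;> norm_num)).const_mul (r := 1 / 2) (by norm_num))
    refine ⟨(h2.const_mul (inv_nonneg.2 (hw ε hε).le)).congr fun u hu => ?_, ?_, ?_⟩
    · simp only [g, if_pos hu]
      ring
    · have : (1 : ℝ) ∈ Icc (-1 : ℝ) 1 := by simp
      simp only [g, if_pos this, mul_one, hf1]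
      exact inv_mul_cancel₀ (hw ε hε).ne'
    · intro u hu
      simp only [g, if_neg hu]
  have hseg : f ∈ openSegment ℝ (g 1) (g (-1)) := by
    have h1 := hw 1 (Or.inl rfl)
    have h2 := hw (-1) (Or.inr rfl)
    refine ⟨w 1 / 2, w (-1) / 2, by positivity, by positivity, by simp only [w]; ring, ?_⟩
    ext u
    by_cases hu : u ∈ Icc (-1 : ℝ) 1
    · simp only [g, Pi.add_apply, Pi.smul_apply, smul_eq_mul, if_pos hu]
      field_simp
      ring
    · simp only [g, Pi.add_apply, Pi.smul_apply, smul_eq_mul, if_neg hu, hf0 u hu]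
      ring
  have key := congr_fun (hext (hg 1 (Or.inl rfl)) (hg (-1) (Or.inr rfl)) hseg) t
  simp only [g, if_pos ht] at key
  rw [inv_mul_eq_iff_eq_mul₀ (hw 1 (Or.inl rfl)).ne'] at key
  simp only [w] at key
  linarith

/-- Exchanging s and t yields equality, so log f(t) / log t is constant and f is a power.
Monotonicity compares the integer powers of s and t. -/
theorem mul_log_le_of_map_pow {f : ℝ → ℝ}
    (h1 : f 1 = 1) (hpow : ∀ t ∈ Icc (-1 : ℝ) 1, ∀ n : ℕ, f (t ^ n) = f t ^ n)
    (hmono : MonotoneOn f (Icc 0 1)) (hpos : ∀ t ∈ Ioo (0 : ℝ) 1, 0 < f t)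
    {s t : ℝ} (hs : s ∈ Ioo (0 : ℝ) 1) (ht : t ∈ Ioo (0 : ℝ) 1) :
    Real.log (f s) * Real.log t ≤ Real.log (f t) * Real.log s := by
  have hx := Real.log_neg ht.1 ht.2
  have hy := Real.log_neg hs.1 hs.2
  have hv : Real.log (f s) ≤ 0 := Real.log_nonpos (hpos s hs).le
    (h1 ▸ hmono ⟨hs.1.le, hs.2.le⟩ ⟨zero_le_one, le_rfl⟩ hs.2.le)
  have key : ∀ q : ℕ, q * (Real.log (f s) * Real.log t - Real.log (f t) * Real.log s) ≤
      Real.log (f s) * Real.log s := by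
    intro q
    -- The largest p with t^q ≤ s^p. Rounding costs an error independent of q, so letting q grow
    -- gives the inequality.
    set p := ⌊q * (Real.log t / Real.log s)⌋₊
    have hp1 : (p : ℝ) ≤ q * (Real.log t / Real.log s) :=
      Nat.floor_le (mul_nonneg (Nat.cast_nonneg q) (div_nonneg_of_nonpos hx.le hy.le))
    have hp2 : q * (Real.log t / Real.log s) < p + 1 := Nat.lt_floor_add_one _
    have e : q * (Real.log t / Real.log s) * Real.log s = q * Real.log t := by
      rw [mul_assoc, div_mul_cancel₀ _ hy.ne]
    have hp3 : q * Real.log t ≤ p * Real.log s := by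
      rw [← e]; exact mul_le_mul_of_nonpos_right hp1 hy.le
    have hp4 : (p + 1) * Real.log s ≤ q * Real.log t := by
      rw [← e]; exact mul_le_mul_of_nonpos_right hp2.le hy.le
    have hle : t ^ q ≤ s ^ p := by
      rw [← Real.log_le_log_iff (pow_pos ht.1 _) (pow_pos hs.1 _), Real.log_pow, Real.log_pow]
      exact hp3
    have hle2 := hmono ⟨pow_nonneg ht.1.le _, pow_le_one₀ ht.1.le ht.2.le⟩
      ⟨pow_nonneg hs.1.le _, pow_le_one₀ hs.1.le hs.2.le⟩ hle
    rw [hpow t ⟨by linarith [ht.1], ht.2.le⟩, hpow s ⟨by linarith [hs.1], hs.2.le⟩,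
      ← Real.log_le_log_iff (pow_pos (hpos t ht) _) (pow_pos (hpos s hs) _), Real.log_pow,
      Real.log_pow] at hle2
    nlinarith [mul_le_mul_of_nonpos_right hle2 hy.le, mul_le_mul_of_nonpos_left hp4 hv]
  by_contra! hlt
  obtain ⟨q, hq⟩ := exists_nat_gt ((Real.log (f s) * Real.log s) /
    (Real.log (f s) * Real.log t - Real.log (f t) * Real.log s))
  rw [div_lt_iff₀ (by linarith)] at hq
  linarith [key q]

/-- Multiplicative preservers are monomials or vanish on `(-1, 1)`. -/
theorem eq_pow_or_eq_zero_of_map_mul {f : ℝ → ℝ} (hf : PreservesPosSemidef (Icc (-1) 1) f)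
    (h1 : f 1 = 1) (hmul : ∀ a ∈ Icc (-1 : ℝ) 1, ∀ t ∈ Icc (-1 : ℝ) 1, f (a * t) = f a * f t) :
    (∃ k : ℕ, ∀ t ∈ Ioo (-1 : ℝ) 1, f t = t ^ k) ∨ ∀ t ∈ Ioo (-1 : ℝ) 1, f t = 0 := by
  have hpow : ∀ t ∈ Icc (-1 : ℝ) 1, ∀ n : ℕ, f (t ^ n) = f t ^ n := by
    intro t ht n
    have hmem : ∀ n : ℕ, t ^ n ∈ Icc (-1 : ℝ) 1 := fun n => by
      rw [mem_Icc, ← abs_le, abs_pow]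
      exact pow_le_one₀ (abs_nonneg _) (abs_le.2 ht)
    induction n with
    | zero => simpa using h1
    | succ n ih => rw [pow_succ, pow_succ, hmul _ (hmem n) _ ht, ih]
  have hnn : ∀ t ∈ Icc (0 : ℝ) 1, 0 ≤ f t := fun t ht =>
    hf.nonneg ht.1 ⟨by linarith [ht.1], ht.2⟩
  have hmono : MonotoneOn f (Icc 0 1) := by
    intro s hs t ht hst
    rcases ht.1.eq_or_lt with rfl | h0
    · rw [le_antisymm hst hs.1]
    · have hmem : s / t ∈ Icc (-1 : ℝ) 1 :=
        ⟨by linarith [div_nonneg hs.1 ht.1], (div_le_one h0).2 hst⟩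
      rw [← div_mul_cancel₀ s h0.ne', hmul _ hmem _ ⟨by linarith, ht.2⟩]
      have := (abs_le.1 (hf.abs_le_apply_one hmem)).2
      exact mul_le_of_le_one_left (hnn t ht) (h1 ▸ this)
  -- From f(0) = f(0) f(t), a nonzero f(0) forces f = 1.
  by_cases h00 : f 0 = 0
  swap
  · refine Or.inl ⟨0, fun t ht => ?_⟩
    have := hmul 0 (by simp) t ⟨ht.1.le, ht.2.le⟩
    rw [zero_mul] at this
    simpa using (mul_left_cancel₀ h00 (by rw [← this, mul_one])).symm
  have hε : f (-1) = 1 ∨ f (-1) = -1 := by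
    have h2 := hmul (-1) (by simp) (-1) (by simp)
    norm_num [h1] at h2
    exact mul_self_eq_one_iff.1 h2.symm
  have hneg : ∀ t ∈ Icc (-1 : ℝ) 1, f (-t) = f (-1) * f t := fun t ht => by
    rw [← hmul _ (by simp) _ ht, neg_one_mul]
  -- A single zero s spreads: some power of t lies below s, and monotonicity gives f(t)^n = 0.
  by_cases hz : ∃ s ∈ Ioo (0 : ℝ) 1, f s = 0
  · obtain ⟨s, hs, hs0⟩ := hz
    have hzero : ∀ t ∈ Ioo (0 : ℝ) 1, f t = 0 := by
      intro t ht
      obtain ⟨n, hn⟩ := exists_pow_lt_of_lt_one hs.1 ht.2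
      have hmem : t ^ n ∈ Icc (0 : ℝ) 1 := ⟨pow_nonneg ht.1.le _, pow_le_one₀ ht.1.le ht.2.le⟩
      have h2 := hmono hmem ⟨hs.1.le, hs.2.le⟩ hn.le
      rw [hs0] at h2
      have h3 := le_antisymm h2 (hnn _ hmem)
      rw [hpow t ⟨by linarith [ht.1], ht.2.le⟩] at h3
      exact eq_zero_of_pow_eq_zero h3
    refine Or.inr fun t ht => ?_
    rcases lt_trichotomy t 0 with h | rfl | h
    · rw [← neg_neg t, hneg (-t) ⟨by linarith [ht.1, ht.2], by linarith [ht.1]⟩,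
        hzero (-t) ⟨by linarith, by linarith [ht.1]⟩, mul_zero]
    · exact h00
    · exact hzero t ⟨h, ht.2⟩
  · push Not at hz
    have hpos : ∀ t ∈ Ioo (0 : ℝ) 1, 0 < f t := fun t ht =>
      (hnn t ⟨ht.1.le, ht.2.le⟩).lt_of_ne' (hz t ht)
    have hhalf : (1 / 2 : ℝ) ∈ Ioo (0 : ℝ) 1 := by norm_num
    have hl := Real.log_neg hhalf.1 hhalf.2
    set α := Real.log (f (1 / 2)) / Real.log (1 / 2)
    have hα : 0 ≤ α := div_nonneg_of_nonpos (Real.log_nonpos (hpos _ hhalf).le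
      ((hmono ⟨hhalf.1.le, hhalf.2.le⟩ ⟨zero_le_one, le_rfl⟩ hhalf.2.le).trans_eq h1)) hl.le
    have hfα : ∀ t ∈ Ioo (0 : ℝ) 1, f t = t ^ α := by
      intro t ht
      have e := le_antisymm (mul_log_le_of_map_pow h1 hpow hmono hpos hhalf ht)
        (mul_log_le_of_map_pow h1 hpow hmono hpos ht hhalf)
      apply Real.log_injOn_pos (hpos t ht) (Real.rpow_pos_of_pos ht.1 _)
      rw [Real.log_rpow ht.1, div_mul_eq_mul_div, e, mul_div_cancel_right₀ _ hl.ne]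
    have hsp0 : ∀ t ∈ Ioc (0 : ℝ) 1, f t = t ^ α := by
      intro t ht
      rcases ht.2.eq_or_lt with rfl | h
      · simp [h1]
      · exact hfα t ⟨ht.1, h⟩
    have hsp : EqOn f (signedPower α (f (-1))) (Icc (-1) 1) := by
      intro t ht
      rcases lt_trichotomy t 0 with h | rfl | h
      · rw [signedPower_of_neg _ _ h, ← hsp0 (-t) ⟨by linarith, by linarith [ht.1]⟩,
          ← hneg _ ⟨by linarith [ht.1, ht.2], by linarith [ht.1]⟩, neg_neg]
      · rw [h00, signedPower_zero]
      · rw [signedPower_of_pos _ _ h, hsp0 t ⟨h, ht.2⟩]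
    obtain ⟨n, hn⟩ := exists_nat_ge α
    obtain ⟨k, hk0, hk, hεk⟩ := PreservesPosSemidef.exists_eq_natCast_of_signedPower n hα hn hε
      (hf.congr hsp).signedPower_univ
    refine Or.inl ⟨k, fun t ht => ?_⟩
    rw [hsp ⟨ht.1.le, ht.2.le⟩, hεk, hk]
    rcases lt_trichotomy t 0 with h | rfl | h
    · rw [signedPower_of_neg _ _ h, Real.rpow_natCast, ← mul_pow]
      simp
    · rw [signedPower_zero, zero_pow hk0]
    · rw [signedPower_of_pos _ _ h, Real.rpow_natCast]

/-! ### Power series of mass at most one, and representation of preservers -/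

/-- Nonnegative coefficient sequences of total mass at most one. -/
def subprobabilitySequences : Set (ℕ → ℝ) :=
  {a | (∀ n, 0 ≤ a n) ∧ ∀ s : Finset ℕ, ∑ n ∈ s, a n ≤ 1}

/-- The functions that are represented on `(-1, 1)` by a power series with nonnegative
coefficients of total mass at most one. -/
def subprobabilitySeries : Set (ℝ → ℝ) :=
  {f | ∃ a ∈ subprobabilitySequences, ∀ t ∈ Ioo (-1 : ℝ) 1, HasSum (fun n => a n * t ^ n) (f t)}

theorem norm_mul_pow_le_of_mem {a : ℕ → ℝ} (ha : a ∈ subprobabilitySequences) (n : ℕ) (t : ℝ) :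
    ‖a n * t ^ n‖ ≤ |t| ^ n := by
  have h := ha.2 {n}
  rw [Finset.sum_singleton] at h
  rw [norm_mul, norm_pow, Real.norm_of_nonneg (ha.1 n), Real.norm_eq_abs]
  exact mul_le_of_le_one_left (by positivity) h

theorem convex_subprobabilitySeries : Convex ℝ subprobabilitySeries := by
  rintro f ⟨a, ⟨ha, ha1⟩, hfa⟩ g ⟨b, ⟨hb, hb1⟩, hgb⟩ p q hp hq hpq
  refine ⟨fun n => p * a n + q * b n, ⟨fun n => add_nonneg (mul_nonneg hp (ha n))
    (mul_nonneg hq (hb n)), fun s => ?_⟩, fun t ht => ?_⟩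
  · rw [Finset.sum_add_distrib, ← Finset.mul_sum, ← Finset.mul_sum]
    nlinarith [ha1 s, hb1 s]
  · refine (((hfa t ht).mul_left p).add ((hgb t ht).mul_left q)).congr_fun fun n => ?_
    ring

theorem isCompact_subprobabilitySequences : IsCompact subprobabilitySequences := by
  refine (isCompact_univ_pi fun _ : ℕ => isCompact_Icc (a := (0 : ℝ)) (b := 1)).of_isClosed_subset
    ?_ fun a ha n _ => ⟨ha.1 n, by simpa using ha.2 {n}⟩
  have h1 : IsClosed {a : ℕ → ℝ | ∀ n, 0 ≤ a n} := by
    simp only [Set.ofPred_forall]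
    exact isClosed_iInter fun n => isClosed_le continuous_const (by fun_prop)
  have h2 : IsClosed {a : ℕ → ℝ | ∀ s : Finset ℕ, ∑ n ∈ s, a n ≤ 1} := by
    simp only [Set.ofPred_forall]
    exact isClosed_iInter fun s => isClosed_le (by fun_prop) continuous_const
  exact h1.inter h2

/-- The geometric bound |t|^n makes summation continuous on the compact set of coefficient
sequences, so the image is compact. Mass at most one, not exactly one, is needed: t^k tends to 0 on
(-1, 1), so mass can escape to infinity. -/
theorem isClosed_subprobabilitySeries : IsClosed subprobabilitySeries := by
  let Φ : (ℕ → ℝ) → Ioo (-1 : ℝ) 1 → ℝ := fun a t => ∑' n, a n * (t : ℝ) ^ n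
  have hΦ : ContinuousOn Φ subprobabilitySequences := by
    refine continuousOn_pi.2 fun t => ?_
    refine continuousOn_tsum (u := fun n => |(t : ℝ)| ^ n)
      (fun n => (by fun_prop : Continuous fun a : ℕ → ℝ => a n * (t : ℝ) ^ n).continuousOn)
      (summable_geometric_of_lt_one (abs_nonneg _) ?_) fun n a ha => norm_mul_pow_le_of_mem ha n t
    exact abs_lt.2 t.2
  have h := (isCompact_subprobabilitySequences.image_of_continuousOn hΦ).isClosed.preimage
    (f := fun (f : ℝ → ℝ) (t : Ioo (-1 : ℝ) 1) => f t) (by fun_prop)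
  convert h using 1
  ext f
  constructor
  · rintro ⟨a, ha, hfa⟩
    exact ⟨a, ha, funext fun t => (hfa t t.2).tsum_eq⟩
  · rintro ⟨a, ha, hfa⟩
    refine ⟨a, ha, fun t ht => ?_⟩
    have hs : Summable fun n => a n * t ^ n :=
      Summable.of_norm_bounded (summable_geometric_of_lt_one (abs_nonneg _) (abs_lt.2 ht))
        fun n => norm_mul_pow_le_of_mem ha n t
    have := congr_fun hfa ⟨t, ht⟩
    simp only [Φ] at this
    exact this ▸ hs.hasSum

theorem normalizedPreservers_subset_subprobabilitySeries :
    normalizedPreservers ⊆ subprobabilitySeries := by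
  rw [← closure_convexHull_extremePoints isCompact_normalizedPreservers
    convex_normalizedPreservers]
  refine closure_minimal (convexHull_min (fun f hf => ?_) convex_subprobabilitySeries)
    isClosed_subprobabilitySeries
  rcases eq_pow_or_eq_zero_of_map_mul hf.1.1 hf.1.2.1
    fun a ha t ht => map_mul_of_mem_extremePoints hf ha ht with ⟨k, hk⟩ | h0
  · refine ⟨Pi.single k 1, ⟨fun n => ?_, fun s => ?_⟩, fun t ht => ?_⟩
    · by_cases h : n = k <;> simp [h]
    · simp only [Pi.single_apply, Finset.sum_ite_eq']
      split_ifs <;> norm_num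
    · rw [hk t ht]
      convert hasSum_single (f := fun n => (Pi.single k 1 : ℕ → ℝ) n * t ^ n) k ?_ using 1
      · simp
      · intro n hn
        simp [hn]
  · exact ⟨0, ⟨fun _ => le_rfl, fun s => by simp⟩, fun t ht => by simp [h0 t ht]⟩

theorem PreservesPosSemidef.comp_mul {f : ℝ → ℝ} (hf : PreservesPosSemidef univ f) {r : ℝ}
    (hr : 0 ≤ r) : PreservesPosSemidef univ fun t => f (r * t) := fun ι _ A hA _ c => by
  simpa using hf ι (r • A) (hA.smul hr) (fun _ _ => mem_univ _) c

theorem PreservesPosSemidef.mono {s t : Set ℝ} {f : ℝ → ℝ} (hf : PreservesPosSemidef t f)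
    (hst : s ⊆ t) : PreservesPosSemidef s f := fun ι _ A hA hs =>
  hf ι A hA fun i j => hst (hs i j)

theorem PreservesPosSemidef.exists_hasSum_of_abs_lt {f : ℝ → ℝ}
    (hf : PreservesPosSemidef univ f) {R : ℝ} (hR : 0 < R) :
    ∃ a : ℕ → ℝ, (∀ n, 0 ≤ a n) ∧ ∀ t, |t| < R → HasSum (fun n => a n * t ^ n) (f t) := by
  classical
  have hg := (hf.comp_mul hR.le).mono (subset_univ (Icc (-1 : ℝ) 1))
  have hmem : ∀ t, |t| < R → t / R ∈ Ioo (-1 : ℝ) 1 := fun t ht => by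
    rw [mem_Ioo, ← abs_lt, abs_div, abs_of_pos hR]
    exact (div_lt_one hR).2 ht
  have hdiv : ∀ t, R * (t / R) = t := fun t => mul_div_cancel₀ t hR.ne'
  -- If f(R) = 0, normalization is impossible, but |f| ≤ f(R) makes f vanish.
  rcases (hf.nonneg hR.le (mem_univ R)).eq_or_lt' with h0 | h0
  · refine ⟨0, fun _ => le_rfl, fun t ht => ?_⟩
    have := hg.abs_le_apply_one (Ioo_subset_Icc_self (hmem t ht))
    rw [hdiv, mul_one, h0] at this
    simp [abs_nonpos_iff.1 this]
  · let h : ℝ → ℝ := fun t => if t ∈ Icc (-1 : ℝ) 1 then (f R)⁻¹ * f (R * t) else 0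
    have hh : h ∈ normalizedPreservers := by
      refine ⟨(hg.const_mul (inv_nonneg.2 h0.le)).congr fun t ht => ?_, ?_, fun t ht => ?_⟩
      · simp only [h, if_pos ht]
      · simp [h, h0.ne']
      · simp only [h, if_neg ht]
    obtain ⟨a, ha, hsum⟩ := normalizedPreservers_subset_subprobabilitySeries hh
    refine ⟨fun n => f R * (a n / R ^ n), fun n =>
      mul_nonneg h0.le (div_nonneg (ha.1 n) (pow_nonneg hR.le _)), fun t ht => ?_⟩
    have key := (hsum _ (hmem t ht)).mul_left (f R)
    simp only [h, if_pos (Ioo_subset_Icc_self (hmem t ht)), hdiv, mul_inv_cancel_left₀ h0.ne']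
      at key
    refine key.congr_fun fun n => ?_
    rw [div_pow]
    ring

theorem coeff_unique_of_hasSum_pow {a b : ℕ → ℝ} {f : ℝ → ℝ} {r : ℝ} (hr : 0 < r)
    (ha : ∀ t, |t| < r → HasSum (fun n => a n * t ^ n) (f t))
    (hb : ∀ t, |t| < r → HasSum (fun n => b n * t ^ n) (f t)) : a = b := by
  have key : ∀ a : ℕ → ℝ, (∀ t, |t| < r → HasSum (fun n => a n * t ^ n) (f t)) →
      HasFPowerSeriesAt f (FormalMultilinearSeries.ofScalars ℝ a) 0 := by
    intro a ha
    rw [hasFPowerSeriesAt_iff]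
    filter_upwards [Metric.ball_mem_nhds (0 : ℝ) hr] with t ht
    rw [zero_add]
    refine (ha t (by simpa using ht)).congr_fun fun n => ?_
    simp [FormalMultilinearSeries.coeff_ofScalars, mul_comm]
  have h := (key a ha).eq_formalMultilinearSeries (key b hb)
  ext n
  simpa [FormalMultilinearSeries.coeff_ofScalars] using congrArg (fun p => p.coeff n) h

/-- Functions preserving positive semidefiniteness in all dimensions are entire, with nonnegative
Taylor coefficients. -/
theorem PreservesPosSemidef.exists_hasSum {f : ℝ → ℝ} (hf : PreservesPosSemidef univ f) :
    ∃ a : ℕ → ℝ, (∀ n, 0 ≤ a n) ∧ ∀ t, HasSum (fun n => a n * t ^ n) (f t) := by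
  obtain ⟨a, ha, hsum⟩ := hf.exists_hasSum_of_abs_lt zero_lt_one
  refine ⟨a, ha, fun t => ?_⟩
  obtain ⟨b, -, hb⟩ := hf.exists_hasSum_of_abs_lt (R := |t| + 1) (by positivity)
  rw [coeff_unique_of_hasSum_pow zero_lt_one hsum fun u hu =>
    hb u (hu.trans_le (by simp))]
  exact hb t (by simp)

/-! ### From kernels on ℓ² to entrywise preservers -/

theorem orthonormal_single_one : Orthonormal ℝ fun k : ℕ => (lp.single 2 k (1 : ℝ) : EllTwo) := by
  classical
  rw [orthonormal_iff_ite]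
  intro i j
  rw [lp.inner_single_left]
  simp [lp.single_apply, Pi.single_apply]

/-- Positive semidefinite matrices are Gram matrices of vectors in `ℓ²`. -/
theorem exists_inner_eq_of_posSemidef {ι : Type} [Fintype ι] {A : Matrix ι ι ℝ}
    (hA : A.PosSemidef) : ∃ x : ι → EllTwo, ∀ i j, inner ℝ (x i) (x j) = A i j := by
  classical
  obtain ⟨m, v, rfl⟩ := Matrix.posSemidef_iff_eq_sum_vecMulVec.1 hA
  have ho := orthonormal_single_one.comp (fun k : Fin m => (k : ℕ)) Fin.val_injective
  refine ⟨fun i => ∑ k, v k i • (lp.single 2 (k : ℕ) (1 : ℝ) : EllTwo), fun i j => ?_⟩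
  have := ho.inner_sum (fun k => v k i) (fun k => v k j) Finset.univ
  simp only [Function.comp_def] at this
  rw [this, Matrix.sum_apply]
  simp [Matrix.vecMulVec_apply]

theorem IsPosDefKernel.nonneg_of_fintype {X : Type*} {K : X → X → ℂ} (hK : IsPosDefKernel K)
    {ι : Type*} [Fintype ι] (x : ι → X) (c : ι → ℝ) :
    0 ≤ (∑ i, ∑ j, ((c i * c j : ℝ) : ℂ) * K (x i) (x j)).re := by
  let e := (Fintype.equivFin ι).symm
  have h := (Complex.le_def.1 (hK _ (x ∘ e) fun i => (c (e i) : ℂ))).1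
  rw [← e.sum_comp]
  simp_rw [← e.sum_comp (fun j => ((c _ * c j : ℝ) : ℂ) * K (x _) (x j))]
  simpa using h

theorem IsPosDefKernel.conj_symm {X : Type*} {K : X → X → ℂ} (hK : IsPosDefKernel K) (x y : X) :
    (K x y).im = - (K y x).im := by
  have h0 : ∀ x, (K x x).im = 0 := fun x => by
    simpa using (Complex.le_def.1 (hK 1 ![x] ![1])).2.symm
  have h := (Complex.le_def.1 (hK 2 ![x, y] ![1, 1])).2
  simp [Fin.sum_univ_two, h0] at h
  linarith

/-- A positive definite dot product kernel on `ℓ²` has a power series expansion. -/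
theorem exists_expansion_of_isPosDefKernel {K : EllTwo → EllTwo → ℂ}
    (hdot : IsDotProductFunction K) (hK : IsPosDefKernel K) :
    ∃ a : ℕ → ℝ, (∀ n, 0 ≤ a n) ∧ (∀ t : ℝ, Summable fun n : ℕ => a n * t ^ n) ∧
      HasDotProductExpansion K a := by
  obtain ⟨κ, hκ⟩ := hdot
  -- The kernel is symmetric because the inner product is, and the imaginary part is antisymmetric
  -- by `conj_symm`; hence it vanishes.
  have hreal : ∀ x y, (((κ (inner ℝ x y)).re : ℝ) : ℂ) = K x y := by
    intro x y
    rw [hκ]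
    refine Complex.ext rfl ?_
    have := hK.conj_symm x y
    rw [hκ, hκ, real_inner_comm x y] at this
    rw [Complex.ofReal_im]
    linarith
  have hf : PreservesPosSemidef univ fun t => (κ t).re := by
    intro ι _ A hA _ c
    obtain ⟨x, hx⟩ := exists_inner_eq_of_posSemidef hA
    have h := hK.nonneg_of_fintype x c
    simp only [← hreal, hx] at h
    exact_mod_cast h
  obtain ⟨a, ha, hsum⟩ := hf.exists_hasSum
  refine ⟨a, ha, fun t => (hsum t).summable, fun x y => ?_⟩
  rw [← hreal]
  exact Complex.hasSum_ofReal.2 (hsum _)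

/-! ### Quadratic forms of inner product powers -/

theorem complex_quadratic_eq {ι : Type*} [Fintype ι] (k : ι → ι → ℝ) (hk : ∀ i j, k i j = k j i)
    (c : ι → ℂ) : ∑ i, ∑ j, c i * (starRingEnd ℂ) (c j) * (k i j : ℂ) =
      ((∑ i, ∑ j, (c i).re * (c j).re * k i j + ∑ i, ∑ j, (c i).im * (c j).im * k i j : ℝ) : ℂ) := by
  refine Complex.ext ?_ ?_
  · simp only [Complex.re_sum, Complex.ofReal_re, ← Finset.sum_add_distrib]
    refine Finset.sum_congr rfl fun i _ => Finset.sum_congr rfl fun j _ => ?_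
    simp
    ring
  · have e : ∀ i j, (c i * (starRingEnd ℂ) (c j) * (k i j : ℂ)).im =
        (c i).im * (c j).re * k i j - (c i).re * (c j).im * k i j := fun i j => by
      simp
      ring
    simp only [Complex.im_sum, Complex.ofReal_im, e, Finset.sum_sub_distrib]
    rw [sub_eq_zero, Finset.sum_comm]
    refine Finset.sum_congr rfl fun i _ => Finset.sum_congr rfl fun j _ => ?_
    rw [hk]
    ring

variable {E : Type*} [NormedAddCommGroup E] [InnerProductSpace ℝ E]

/-- Schur's product theorem, applied to Hadamard powers of a Gram matrix. -/
theorem quadratic_inner_pow_nonneg {ι : Type*} [Fintype ι] (x : ι → E) (c : ι → ℝ) (n : ℕ) :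
    0 ≤ ∑ i, ∑ j, c i * c j * inner ℝ (x i) (x j) ^ n := by
  have key : Matrix.PosSemidef (fun i j : ι => inner ℝ (x i) (x j) ^ n) := by
    induction n with
    | zero =>
      refine posSemidef_of_quadratic_nonneg (fun _ _ => by simp) fun c => ?_
      simp only [pow_zero, mul_one, ← Finset.sum_mul_sum]
      exact mul_self_nonneg _
    | succ n ih =>
      exact ih.hadamard (Matrix.posSemidef_gram ℝ x)
  exact key.quadratic_nonneg c

/-- A null vector of a positive semidefinite form lies in its kernel: adjoining y with weight 1 to
the weights s c leaves an expression affine in s and nonnegative for all s, so its slope is zero. -/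
theorem sum_mul_inner_pow_eq_zero {ι : Type*} [Fintype ι] {x : ι → E} {c : ι → ℝ} {n : ℕ}
    (h : ∑ i, ∑ j, c i * c j * inner ℝ (x i) (x j) ^ n = 0) (y : E) :
    ∑ i, c i * inner ℝ (x i) y ^ n = 0 := by
  set L := ∑ i, c i * inner ℝ (x i) y ^ n
  have key : ∀ s : ℝ, 0 ≤ 2 * s * L + inner ℝ y y ^ n := by
    intro s
    have h1 := quadratic_inner_pow_nonneg (fun o : Option ι => o.elim y x)
      (fun o => o.elim 1 fun i => s * c i) n
    simp only [Fintype.sum_option, Option.elim_none, Option.elim_some, Finset.sum_add_distrib,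
      one_mul, mul_one] at h1
    have e1 : ∑ j, s * c j * inner ℝ y (x j) ^ n = s * L := by
      simp only [L, Finset.mul_sum, mul_assoc, real_inner_comm]
    have e2 : ∑ i, s * c i * inner ℝ (x i) y ^ n = s * L := by
      simp only [L, Finset.mul_sum, mul_assoc]
    have e3 : ∑ i, ∑ j, s * c i * (s * c j) * inner ℝ (x i) (x j) ^ n = 0 := by
      rw [← mul_zero (s * s), ← h, Finset.mul_sum]
      refine Finset.sum_congr rfl fun i _ => ?_
      rw [Finset.mul_sum]
      exact Finset.sum_congr rfl fun j _ => by ring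
    rw [e1, e2, e3] at h1
    linarith
  by_contra hL
  have := key (-(inner ℝ y y ^ n + 1) / (2 * L))
  have e : 2 * (-(inner ℝ y y ^ n + 1) / (2 * L)) * L = -(inner ℝ y y ^ n + 1) := by
    field_simp
  linarith

theorem exists_forall_inner_ne_zero {ι : Type*} [Finite ι] (v : ι → E) (hv : ∀ i, v i ≠ 0) :
    ∃ y, ∀ i, inner ℝ (v i) y ≠ 0 :=
  Module.Dual.exists_forall_ne_zero_of_forall_exists (fun i => (innerₛₗ ℝ (v i) : E →ₗ[ℝ] ℝ))
    fun i => ⟨v i, by simpa using hv i⟩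

/-- The limit of `r ^ n` over those `n` with `(-1) ^ n = ε`. -/
theorem tendsto_pow_of_parity {l : Filter ℕ} (hl : l ≤ atTop) {ε : ℝ}
    (hε : ∀ᶠ n in l, (-1 : ℝ) ^ n = ε) {r : ℝ} (hr : |r| ≤ 1) :
    Tendsto (fun n => r ^ n) l (𝓝 (if r = 1 then 1 else if r = -1 then ε else 0)) := by
  split_ifs with h1 h2
  · simpa [h1] using tendsto_const_nhds
  · subst h2
    exact tendsto_const_nhds.congr' (hε.mono fun n hn => hn.symm)
  · refine (tendsto_pow_atTop_nhds_zero_of_abs_lt_one (lt_of_le_of_ne hr fun h => ?_)).mono_left hl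
    rcases eq_or_eq_neg_of_abs_eq h with h | h <;> contradiction

/-- Power sums vanishing for infinitely many even and infinitely many odd exponents. -/
theorem coeff_eq_zero_of_sum_mul_pow_eq_zero {ι : Type*} [Fintype ι] {t c : ι → ℝ}
    (ht : ∀ i j, t i = t j → i = j) {p : ℕ → Prop}
    (hp : ∀ ε : ℝ, ε = 1 ∨ ε = -1 → {n | (-1 : ℝ) ^ n = ε ∧ p n}.Infinite)
    (hsum : ∀ n, p n → ∑ i, c i * t i ^ n = 0) {i : ι} (hi : t i ≠ 0) : c i = 0 := by
  classical
  by_contra hci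
  -- After division by M^n, M the largest |t_i| in play, only the nodes ±M survive in the limit.
  obtain ⟨m, hm, hmax⟩ := Finset.exists_max_image
    (Finset.univ.filter fun i => c i ≠ 0 ∧ t i ≠ 0) (fun i => |t i|) ⟨i, by simp [hci, hi]⟩
  simp only [Finset.mem_filter, Finset.mem_univ, true_and] at hm hmax
  set M := |t m|
  have hM : 0 < M := abs_pos.2 hm.2
  let L : ℝ → ℝ → ℝ := fun ε r => if r = 1 then 1 else if r = -1 then ε else 0
  have key : ∀ ε : ℝ, ε = 1 ∨ ε = -1 → ∑ i, c i * L ε (t i / M) = 0 := by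
    intro ε hε
    set S := {n | (-1 : ℝ) ^ n = ε ∧ p n}
    have : (atTop ⊓ 𝓟 S).NeBot := by
      rw [← frequently_mem_iff_neBot]
      exact Nat.frequently_atTop_iff_infinite.2 (hp ε hε)
    have hev : ∀ᶠ n in atTop ⊓ 𝓟 S, n ∈ S := mem_inf_of_right (mem_principal_self S)
    have hlim : Tendsto (fun n => ∑ i, c i * (t i / M) ^ n) (atTop ⊓ 𝓟 S)
        (𝓝 (∑ i, c i * L ε (t i / M))) := by
      refine tendsto_finsetSum _ fun i _ => ?_
      by_cases hc : c i = 0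
      · simp [hc]
      refine (tendsto_pow_of_parity inf_le_left (hev.mono fun n hn => hn.1) ?_).const_mul _
      rw [abs_div, abs_of_pos hM, div_le_one hM]
      by_cases h0 : t i = 0
      · simpa [h0] using hM.le
      · exact hmax i ⟨hc, h0⟩
    refine tendsto_nhds_unique hlim (tendsto_const_nhds.congr' (hev.mono fun n hn => ?_))
    simp only [div_pow, mul_div_assoc', ← Finset.sum_div, hsum n hn.2, zero_div]
  set σ := t m / M
  have hσ : σ = 1 ∨ σ = -1 := by
    refine eq_or_eq_neg_of_abs_eq ?_
    rw [abs_div, abs_of_pos hM, div_self hM.ne']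
  -- Weighting the odd limit by σ cancels the node opposite to t_m and doubles t_m itself.
  have h2 : ∑ i, c i * (L 1 (t i / M) + σ * L (-1) (t i / M)) = 0 := by
    simp only [mul_add, mul_left_comm _ σ, Finset.sum_add_distrib, ← Finset.mul_sum,
      key 1 (Or.inl rfl), key (-1) (Or.inr rfl)]
    simp
  have h3 : ∀ i, L 1 (t i / M) + σ * L (-1) (t i / M) = if i = m then 2 else 0 := by
    intro i
    have hiff : t i / M = σ ↔ i = m := by
      rw [div_left_inj' hM.ne']
      exact ⟨ht i m, fun h => h ▸ rfl⟩
    by_cases h : i = m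
    · rw [if_pos h, hiff.2 h]
      rcases hσ with h | h <;> norm_num [L, h]
    · rw [if_neg h]
      have h' := mt hiff.1 h
      rcases hσ with h | h <;> rw [h] at h' ⊢ <;> simp only [L, h', if_false] <;>
        split_ifs <;> norm_num
  simp only [h3, mul_ite, mul_zero, Finset.sum_ite_eq', Finset.mem_univ, if_true] at h2
  exact hm.1 (by linarith)

/-! ### Kernels with a power series expansion, and strict positive definiteness -/

section Expansion

variable {K : EllTwo → EllTwo → ℂ} {a : ℕ → ℝ}

theorem HasDotProductExpansion.hasSum_re (h : HasDotProductExpansion K a) (x y : EllTwo) :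
    HasSum (fun n => a n * inner ℝ x y ^ n) (K x y).re := by
  simpa only [Complex.ofReal_re] using Complex.hasSum_re (h x y)

theorem HasDotProductExpansion.ofReal_re (h : HasDotProductExpansion K a) (x y : EllTwo) :
    (((K x y).re : ℝ) : ℂ) = K x y :=
  (Complex.hasSum_ofReal.2 (h.hasSum_re x y)).unique (h x y)

theorem inner_smul_single (s t : ℝ) :
    inner ℝ (s • (lp.single 2 0 1 : EllTwo)) (t • (lp.single 2 0 1 : EllTwo)) = s * t := by
  have := orthonormal_single_one.1 0
  simp only [real_inner_smul_left, real_inner_smul_right, real_inner_self_eq_norm_sq, this]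
  ring

theorem HasDotProductExpansion.isDotProductFunction (h : HasDotProductExpansion K a) :
    IsDotProductFunction K := by
  refine ⟨fun t => K (t • (lp.single 2 0 1 : EllTwo)) ((1 : ℝ) • (lp.single 2 0 1 : EllTwo)),
    fun x y => (h x y).unique ?_⟩
  simpa only [inner_smul_single, mul_one] using
    h (inner ℝ x y • (lp.single 2 0 1 : EllTwo)) ((1 : ℝ) • (lp.single 2 0 1 : EllTwo))

/-- The classification supplies a nonnegative expansion; restricted to a line, uniqueness of power
series coefficients identifies it with `a`. -/
theorem HasDotProductExpansion.coeff_nonneg (h : HasDotProductExpansion K a)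
    (hK : IsPosDefKernel K) (n : ℕ) : 0 ≤ a n := by
  obtain ⟨b, hb, -, hsum⟩ := exists_expansion_of_isPosDefKernel h.isDotProductFunction hK
  have key : ∀ a, HasDotProductExpansion K a → ∀ t : ℝ, |t| < 1 → HasSum (fun n => a n * t ^ n)
      (K (t • (lp.single 2 0 1 : EllTwo)) ((1 : ℝ) • (lp.single 2 0 1 : EllTwo))).re := by
    intro a ha t _
    simpa only [inner_smul_single, mul_one] using
      ha.hasSum_re (t • (lp.single 2 0 1 : EllTwo)) ((1 : ℝ) • (lp.single 2 0 1 : EllTwo))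
  rw [coeff_unique_of_hasSum_pow zero_lt_one (key a h) (key b hsum)]
  exact hb n

theorem HasDotProductExpansion.hasSum_quadratic (h : HasDotProductExpansion K a)
    {ι : Type*} [Fintype ι] (x : ι → EllTwo) (c : ι → ℝ) :
    HasSum (fun n => a n * ∑ i, ∑ j, c i * c j * inner ℝ (x i) (x j) ^ n)
      (∑ i, ∑ j, c i * c j * (K (x i) (x j)).re) := by
  have key := hasSum_sum (s := Finset.univ) fun i _ => hasSum_sum (s := Finset.univ)
    fun j _ => (h.hasSum_re (x i) (x j)).mul_left (c i * c j)
  refine key.congr_fun fun n => ?_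
  simp only [Finset.mul_sum]
  exact Finset.sum_congr rfl fun i _ => Finset.sum_congr rfl fun j _ => by ring

theorem HasDotProductExpansion.complex_quadratic_eq (h : HasDotProductExpansion K a)
    {ι : Type*} [Fintype ι] (x : ι → EllTwo) (c : ι → ℂ) :
    ∑ i, ∑ j, c i * (starRingEnd ℂ) (c j) * K (x i) (x j) =
      ((∑ i, ∑ j, (c i).re * (c j).re * (K (x i) (x j)).re +
        ∑ i, ∑ j, (c i).im * (c j).im * (K (x i) (x j)).re : ℝ) : ℂ) := by
  rw [← _root_.complex_quadratic_eq (fun i j => (K (x i) (x j)).re) fun i j => ?_]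
  · simp only [h.ofReal_re]
  · have := h.hasSum_re (x j) (x i)
    rw [real_inner_comm] at this
    exact (h.hasSum_re (x i) (x j)).unique this

theorem HasDotProductExpansion.quadratic_nonneg (h : HasDotProductExpansion K a)
    (ha : ∀ n, 0 ≤ a n) {ι : Type*} [Fintype ι] (x : ι → EllTwo) (c : ι → ℝ) :
    0 ≤ ∑ i, ∑ j, c i * c j * (K (x i) (x j)).re :=
  (h.hasSum_quadratic x c).nonneg fun n => mul_nonneg (ha n) (quadratic_inner_pow_nonneg x c n)

theorem HasDotProductExpansion.isPosDefKernel (h : HasDotProductExpansion K a)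
    (ha : ∀ n, 0 ≤ a n) : IsPosDefKernel K := fun m x c => by
  rw [h.complex_quadratic_eq x c]
  exact Complex.zero_le_real.2 (add_nonneg (h.quadratic_nonneg ha x _) (h.quadratic_nonneg ha x _))

theorem continuous_tsum_mul_pow (ha : ∀ t : ℝ, Summable fun n => a n * t ^ n) :
    Continuous fun t : ℝ => ∑' n, a n * t ^ n := by
  refine continuous_iff_continuousAt.2 fun t => ?_
  have hcont : ContinuousOn (fun t : ℝ => ∑' n, a n * t ^ n) (Metric.ball 0 (|t| + 1)) := by
    refine continuousOn_tsum (fun n => by fun_prop) (ha (|t| + 1)).norm fun n u hu => ?_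
    have hu' : |u| ≤ |t| + 1 := by simpa using (mem_ball_zero_iff.1 hu).le
    rw [norm_mul, norm_mul, norm_pow, norm_pow, Real.norm_eq_abs u, Real.norm_eq_abs (|t| + 1),
      abs_of_nonneg (by positivity : 0 ≤ |t| + 1)]
    gcongr
  exact hcont.continuousAt (Metric.isOpen_ball.mem_nhds (by simp))

theorem HasDotProductExpansion.eq_zero_of_quadratic_eq_zero (h : HasDotProductExpansion K a)
    (ha : ∀ n, 0 ≤ a n)
    (hinf : ∀ ε : ℝ, ε = 1 ∨ ε = -1 → {n | (-1 : ℝ) ^ n = ε ∧ 0 < a n}.Infinite)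
    {ι : Type*} [Fintype ι] {x : ι → EllTwo} (hx : Function.Injective x)
    (hx0 : (∀ i, x i ≠ 0) ∨ 0 < a 0) {c : ι → ℝ}
    (hc : ∑ i, ∑ j, c i * c j * (K (x i) (x j)).re = 0) : c = 0 := by
  have hn : ∀ n, 0 < a n → ∀ y, ∑ i, c i * inner ℝ (x i) y ^ n = 0 := by
    intro n hn
    refine sum_mul_inner_pow_eq_zero ?_
    have h1 := h.hasSum_quadratic x c
    rw [hc, hasSum_zero_iff_of_nonneg fun n =>
      mul_nonneg (ha n) (quadratic_inner_pow_nonneg x c n)] at h1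
    exact (mul_eq_zero.1 (congr_fun h1 n)).resolve_left hn.ne'
  -- The index `none` encodes x_i itself and `some j` the difference x_i - x_j, so one y separates
  -- all points and detects the nonzero ones.
  obtain ⟨y, hy⟩ := exists_forall_inner_ne_zero
    (fun v : {v : ι × Option ι // x v.1 - v.2.elim 0 x ≠ 0} => x v.1.1 - v.1.2.elim 0 x)
    fun v => v.2
  have hinj : ∀ i j, inner ℝ (x i) y = inner ℝ (x j) y → i = j := by
    intro i j hij
    by_contra hne
    refine hy ⟨(i, some j), sub_ne_zero.2 (hx.ne hne)⟩ ?_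
    simp [inner_sub_left, hij]
  have hnz : ∀ i, x i ≠ 0 → c i = 0 := fun i hi =>
    coeff_eq_zero_of_sum_mul_pow_eq_zero hinj hinf (fun n hpn => hn n hpn y)
      (by simpa using hy ⟨(i, none), by simpa using hi⟩)
  ext i
  -- All other points are nonzero and already have weight zero, so the identity for n = 0 isolates
  -- c_i.
  by_cases hi : x i = 0
  · have h0 := hn 0 (hx0.resolve_left fun h => h i hi) 0
    simp only [pow_zero, mul_one] at h0
    rwa [Finset.sum_eq_single i (fun j _ hj => hnz j fun h => hj (hx (h.trans hi.symm)))
      (by simp)] at h0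
  · exact hnz i hi

/-- Stated along an injection to cover both ℓ² and ℓ² without the origin. -/
theorem HasDotProductExpansion.isStrictlyPosDefKernel_comp (h : HasDotProductExpansion K a)
    (ha : ∀ n, 0 ≤ a n)
    (hinf : ∀ ε : ℝ, ε = 1 ∨ ε = -1 → {n | (-1 : ℝ) ^ n = ε ∧ 0 < a n}.Infinite)
    {X : Type*} {φ : X → EllTwo} (hφ : Function.Injective φ)
    (h0 : (∀ x, φ x ≠ 0) ∨ 0 < a 0) :
    IsStrictlyPosDefKernel fun x y => K (φ x) (φ y) := by
  refine ⟨fun m x c => h.isPosDefKernel ha m (φ ∘ x) c, fun m x c hx hc => ?_⟩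
  beta_reduce
  rw [h.complex_quadratic_eq (fun i => φ (x i)) c, Complex.zero_lt_real]
  have h1 := h.quadratic_nonneg ha (fun i => φ (x i)) fun i => (c i).re
  have h2 := h.quadratic_nonneg ha (fun i => φ (x i)) fun i => (c i).im
  refine (add_nonneg h1 h2).lt_of_ne' fun hz => hc ?_
  have h0' : (∀ i, φ (x i) ≠ 0) ∨ 0 < a 0 := h0.imp_left fun h i => h (x i)
  have e1 := h.eq_zero_of_quadratic_eq_zero ha hinf (x := fun i => φ (x i)) (hφ.comp hx) h0'
    (c := fun i => (c i).re) (by linarith)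
  have e2 := h.eq_zero_of_quadratic_eq_zero ha hinf (x := fun i => φ (x i)) (hφ.comp hx) h0'
    (c := fun i => (c i).im) (by linarith)
  ext i
  exact Complex.ext (congr_fun e1 i) (congr_fun e2 i)

theorem IsStrictlyPosDefKernel.comp {X Y : Type*} {K : X → X → ℂ} (hK : IsStrictlyPosDefKernel K)
    {φ : Y → X} (hφ : Function.Injective φ) : IsStrictlyPosDefKernel fun x y => K (φ x) (φ y) :=
  ⟨fun m x c => hK.1 m (φ ∘ x) c, fun m x c hx hc => hK.2 m (φ ∘ x) c (hφ.comp hx) hc⟩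

theorem IsStrictlyPosDefKernel.pos_of_fintype {X : Type*} {K : X → X → ℂ}
    (hK : IsStrictlyPosDefKernel K) {ι : Type*} [Fintype ι] {x : ι → X}
    (hx : Function.Injective x) {c : ι → ℝ} (hc : c ≠ 0) :
    0 < ∑ i, ∑ j, c i * c j * (K (x i) (x j)).re := by
  let e := (Fintype.equivFin ι).symm
  have hce : (fun i => (c (e i) : ℂ)) ≠ 0 := fun h => hc <| funext fun i => by
    simpa using congr_fun h (e.symm i)
  have h := (Complex.lt_def.1 (hK.2 _ (x ∘ e) (fun i => (c (e i) : ℂ)) (hx.comp e.injective) hce)).1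
  rw [← e.sum_comp]
  simp_rw [← e.sum_comp (fun j => c _ * c j * (K (x _) (x j)).re)]
  simpa using h

/-- Nontrivial real weights on `1, …, N + 1` annihilating finitely many power functions. -/
theorem exists_ne_zero_sum_mul_pow_eq_zero (F : Finset ℕ) :
    ∃ d : Fin (F.card + 1) → ℝ, d ≠ 0 ∧ ∀ n ∈ F, ∑ k, d k * ((k : ℝ) + 1) ^ n = 0 := by
  let A : Matrix F (Fin (F.card + 1)) ℝ := fun n k => ((k : ℝ) + 1) ^ (n : ℕ)
  have hker : LinearMap.ker A.mulVecLin ≠ ⊥ := LinearMap.ker_ne_bot_of_finrank_lt (by simp)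
  obtain ⟨d, hd, hd0⟩ := (Submodule.ne_bot_iff _).1 hker
  refine ⟨d, hd0, fun n hn => ?_⟩
  have := congr_fun (LinearMap.mem_ker.1 hd) ⟨n, hn⟩
  rw [Matrix.mulVecLin_apply] at this
  simpa only [A, Matrix.mulVec, dotProduct, mul_comm, Pi.zero_apply] using this

theorem HasDotProductExpansion.infinite_of_isStrictlyPosDefKernel (h : HasDotProductExpansion K a)
    (ha : ∀ n, 0 ≤ a n)
    (hK : IsStrictlyPosDefKernel fun x y : {x : EllTwo // x ≠ 0} => K x.1 y.1)
    {ε : ℝ} (hε : ε = 1 ∨ ε = -1) : {n | (-1 : ℝ) ^ n = ε ∧ 0 < a n}.Infinite := by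
  intro hfin
  obtain ⟨d, hd0, hd⟩ := exists_ne_zero_sum_mul_pow_eq_zero hfin.toFinset
  -- Points ±(k + 1)e with weights d_k and ε d_k: powers of parity other than ε cancel in pairs, and
  -- d annihilates the finitely many exponents of parity ε with a_n > 0.
  let ι := Fin (hfin.toFinset.card + 1) × Bool
  let τ : ι → ℝ := fun p => bif p.2 then (p.1 : ℝ) + 1 else -((p.1 : ℝ) + 1)
  let c : ι → ℝ := fun p => bif p.2 then d p.1 else ε * d p.1
  have hτ0 : ∀ p, τ p ≠ 0 := by
    rintro ⟨k, _ | _⟩ <;> simp only [τ, cond_true, cond_false] <;>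
      have : (0 : ℝ) < (k : ℝ) + 1 := by positivity
    · linarith
    · linarith
  have hτ : Function.Injective τ := by
    rintro ⟨k, _ | _⟩ ⟨l, _ | _⟩ hkl <;> simp only [τ, cond_true, cond_false] at hkl <;>
      have h1 : (0 : ℝ) < (k : ℝ) + 1 := by positivity
    all_goals have h2 : (0 : ℝ) < (l : ℝ) + 1 := by positivity
    · rw [Fin.ext (by simpa using hkl : (k : ℕ) = l)]
    · linarith
    · linarith
    · rw [Fin.ext (by simpa using hkl : (k : ℕ) = l)]
  have he : (lp.single 2 0 1 : EllTwo) ≠ 0 := orthonormal_single_one.ne_zero 0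
  let x : ι → {x : EllTwo // x ≠ 0} := fun p => ⟨τ p • lp.single 2 0 1, smul_ne_zero (hτ0 p) he⟩
  have hx : Function.Injective x := fun p q hpq =>
    hτ (smul_left_injective ℝ he (congrArg Subtype.val hpq))
  have hc : c ≠ 0 := fun h => hd0 <| funext fun k => by simpa [c] using congr_fun h (k, true)
  refine (hK.pos_of_fintype hx hc).ne ((hasSum_zero.congr_fun fun n => ?_).unique
    (h.hasSum_quadratic (fun p => (x p).1) c))
  have e : ∑ i, ∑ j, c i * c j * inner ℝ (x i).1 (x j).1 ^ n =
      (∑ i, c i * τ i ^ n) ^ 2 := by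
    rw [sq, Finset.sum_mul_sum]
    refine Finset.sum_congr rfl fun i _ => Finset.sum_congr rfl fun j _ => ?_
    simp only [x, inner_smul_single, mul_pow]
    ring
  have e2 : ∑ i, c i * τ i ^ n = (1 + ε * (-1) ^ n) * ∑ k, d k * ((k : ℝ) + 1) ^ n := by
    rw [Fintype.sum_prod_type, Finset.mul_sum]
    refine Finset.sum_congr rfl fun k _ => ?_
    simp only [Fintype.sum_bool, c, τ, cond_true, cond_false]
    rw [neg_pow]
    ring
  rw [e, e2]
  rcases (ha n).eq_or_lt with h0 | h0
  · simp [← h0]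
  by_cases hn : (-1 : ℝ) ^ n = ε
  · rw [hd n (hfin.mem_toFinset.2 ⟨hn, h0⟩)]
    simp
  · have : 1 + ε * (-1 : ℝ) ^ n = 0 := by
      rcases hε with rfl | rfl <;> rcases neg_one_pow_eq_or ℝ n with h | h <;>
        simp_all
    simp [this]

theorem forall_parity_infinite_iff :
    (∀ ε : ℝ, ε = 1 ∨ ε = -1 → {n | (-1 : ℝ) ^ n = ε ∧ 0 < a n}.Infinite) ↔
      {n : ℕ | Even n ∧ 0 < a n}.Infinite ∧ {n : ℕ | Odd n ∧ 0 < a n}.Infinite := by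
  have hodd : ∀ n : ℕ, (-1 : ℝ) ^ n = -1 ↔ Odd n :=
    fun n => neg_one_pow_eq_neg_one_iff_odd (by norm_num)
  have heven : ∀ n : ℕ, (-1 : ℝ) ^ n = 1 ↔ Even n :=
    fun n => neg_one_pow_eq_one_iff_even (by norm_num)
  simp only [forall_eq_or_imp, forall_eq, hodd, heven]

end Expansion

end

theorem mainTheorem5 :
    (∀ K : EllTwo → EllTwo → ℂ,
      IsDotProductFunction K → Continuous (Function.uncurry K) → IsPosDefKernel K →
        ∃ a : ℕ → ℝ, (∀ n, 0 ≤ a n) ∧ (∀ t : ℝ, Summable fun n : ℕ => a n * t ^ n) ∧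
          HasDotProductExpansion K a) ∧
    (∀ a : ℕ → ℝ, (∀ n, 0 ≤ a n) → (∀ t : ℝ, Summable fun n : ℕ => a n * t ^ n) →
        ∃ K : EllTwo → EllTwo → ℂ, HasDotProductExpansion K a ∧
          IsDotProductFunction K ∧ Continuous (Function.uncurry K) ∧ IsPosDefKernel K) ∧
    (∀ (K : EllTwo → EllTwo → ℂ) (a : ℕ → ℝ),
      IsPosDefKernel K → HasDotProductExpansion K a →
        (IsStrictlyPosDefKernel K ↔
          0 < a 0 ∧ {n : ℕ | Even n ∧ 0 < a n}.Infinite ∧ {n : ℕ | Odd n ∧ 0 < a n}.Infinite) ∧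
        (IsStrictlyPosDefKernel (fun x y : {x : EllTwo // x ≠ 0} => K x.1 y.1) ↔
          {n : ℕ | Even n ∧ 0 < a n}.Infinite ∧ {n : ℕ | Odd n ∧ 0 < a n}.Infinite)) := by
  refine ⟨fun K hdot _ hK => exists_expansion_of_isPosDefKernel hdot hK, fun a ha hsum => ?_,
    fun K a hK h => ?_⟩
  · let K : EllTwo → EllTwo → ℂ := fun x y => ((∑' n, a n * inner ℝ x y ^ n : ℝ) : ℂ)
    have h : HasDotProductExpansion K a := fun x y => Complex.hasSum_ofReal.2 (hsum _).hasSum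
    refine ⟨K, h, h.isDotProductFunction, ?_, h.isPosDefKernel ha⟩
    exact Complex.continuous_ofReal.comp ((continuous_tsum_mul_pow hsum).comp continuous_inner)
  · have ha := h.coeff_nonneg hK
    rw [← forall_parity_infinite_iff]
    refine ⟨⟨fun hs => ⟨?_, fun ε hε => h.infinite_of_isStrictlyPosDefKernel ha
      (hs.comp Subtype.val_injective) hε⟩, fun hinf => ?_⟩,
      fun hs ε hε => h.infinite_of_isStrictlyPosDefKernel ha hs hε, fun hinf => ?_⟩
    -- The single point 0 with weight 1 tests K(0, 0), which is a_0 because 0^0 = 1.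
    · have h1 := hs.pos_of_fintype (x := fun _ : Unit => (0 : EllTwo))
        (Function.injective_of_subsingleton _) (c := 1) one_ne_zero
      have h2 := h.hasSum_re 0 0
      have h3 : HasSum (fun n => a n * inner ℝ (0 : EllTwo) 0 ^ n) (a 0) := by
        convert hasSum_single (f := fun n => a n * inner ℝ (0 : EllTwo) 0 ^ n) 0 ?_ using 1
        · simp
        · intro n hn
          simp [hn]
      rw [h2.unique h3] at h1
      simpa using h1
    · exact h.isStrictlyPosDefKernel_comp ha hinf.2 Function.injective_id (Or.inr hinf.1)
    · exact h.isStrictlyPosDefKernel_comp ha hinf Subtype.val_injective (Or.inl fun x => x.2)
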